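/- Let $n\ge 1$, let $\mathbb F_n^+$ be the free monoid on $n$ generators $g_1,\dots,g_n$ with identity $g_0$ (the empty word), and write $|\alpha|$ for the length of $\alpha\in\mathbb F_n^+$. For operators $T_1,\dots,T_n$ in the algebra $B(\mathcal K)$ of bounded operators on a complex Hilbert space $\mathcal K$ put $T_\alpha:=T_{i_1}\cdots T_{i_k}$ if $\alpha=g_{i_1}\cdots g_{i_k}$, and $T_{g_0}:=I_{\mathcal K}$. Tensor products of Hilbert spaces are Hilbert space tensor products. Let $\mathcal H$ be a complex Hilbert space and let $A_{(\alpha)}\in B(\mathcal H)$ for $\alpha\in\mathbb F_n^+$; write $A_{(0)}:=A_{(g_0)}$. Suppose that the series $$F(X_1,\dots,X_n):=\sum_{k=0}^\infty\sum_{|\alpha|=k}X_\alpha\otimes A_{(\alpha)}$$ defines a (universal) holomorphic function with coefficients in $B(\mathcal H)$, that is, its partial sums over $k$ converge in operator norm for every complex Hilbert space $\mathcal X$ and every $(X_1,\dots,X_n)\in B(\mathcal X)^n$ with $\|X_1X_1^*+\cdots+X_nX_n^*\|<1$. Suppose moreover that $F(0)\ge 0$ and that $$\operatorname{Re}F(X_1,\dots,X_n):=\tfrac12\bigl(F(X_1,\dots,X_n)+F(X_1,\dots,X_n)^*\bigr)\le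 I$$ for all such $\mathcal X$ and $(X_1,\dots,X_n)$. Then $$\sum_{k=0}^\infty\Bigl\|\sum_{|\alpha|=k}T_\alpha\otimes A_{(\alpha)}\Bigr\|\le\|A_{(0)}\|+\|I-A_{(0)}\|$$ (in particular, the series on the left converges) for every complex Hilbert space $\mathcal K$ and every $(T_1,\dots,T_n)\in B(\mathcal K)^n$ with $\|T_1T_1^*+\cdots+T_nT_n^*\|^{1/2}\le\frac13$. -/

import Mathlib

open Filter Topology
open scoped TensorProduct ComplexStarModule

universe u v w

/-- The Hilbert space tensor product of two complex Hilbert spaces: the completion of the algebraic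
tensor product for the inner product `⟪x ⊗ h, x' ⊗ h'⟫ = ⟪x, x'⟫ * ⟪h, h'⟫`. -/
abbrev HilbertTensor (X H : Type*) [NormedAddCommGroup X] [InnerProductSpace ℂ X]
    [NormedAddCommGroup H] [InnerProductSpace ℂ H] : Type _ :=
  UniformSpace.Completion (X ⊗[ℂ] H)

section Operators

variable {X H : Type*} [NormedAddCommGroup X] [InnerProductSpace ℂ X]
  [NormedAddCommGroup H] [InnerProductSpace ℂ H]

/-- The tensor product `T ⊗ A` of two bounded operators, acting on the Hilbert tensor product. -/
noncomputable def opTensor (T : X →L[ℂ] X) (A : H →L[ℂ] H) :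
    HilbertTensor X H →L[ℂ] HilbertTensor X H :=
  (TensorProduct.mapL T A).completion

theorem opTensor_tmul (T : X →L[ℂ] X) (A : H →L[ℂ] H) (x : X) (h : H) :
    opTensor T A ((x ⊗ₜ[ℂ] h : X ⊗[ℂ] H) : HilbertTensor X H) =
      ((T x ⊗ₜ[ℂ] A h : X ⊗[ℂ] H) : HilbertTensor X H) := by
  simp [opTensor]

/-- The word `T_α = T_{i₁} ⋯ T_{i_k}` in the operators `T₁, …, Tₙ` for `α = g_{i₁} ⋯ g_{i_k}` in the
free monoid on `n` generators; the empty word gives the identity. -/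
def wordOp {n : ℕ} (T : Fin n → (X →L[ℂ] X)) (α : FreeMonoid (Fin n)) : X →L[ℂ] X :=
  FreeMonoid.lift T α

/-- The homogeneous part `∑_{|α| = k} T_α ⊗ A_(α)`. The words of length `k` are enumerated by
their sequences of letters `Fin k → Fin n`. -/
noncomputable def homogPart {n : ℕ} (A : FreeMonoid (Fin n) → (H →L[ℂ] H))
    (T : Fin n → (X →L[ℂ] X)) (k : ℕ) : HilbertTensor X H →L[ℂ] HilbertTensor X H :=
  ∑ w : Fin k → Fin n,
    opTensor (wordOp T (FreeMonoid.ofList (List.ofFn w))) (A (FreeMonoid.ofList (List.ofFn w)))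

/-- The value `F(X₁, …, Xₙ) = ∑_{k ≥ 0} ∑_{|α| = k} X_α ⊗ A_(α)` of the power series with
coefficients `A`: the limit in operator norm of the partial sums over `k`
(a junk value where they do not converge). -/
noncomputable def seriesValue {n : ℕ} (A : FreeMonoid (Fin n) → (H →L[ℂ] H))
    (T : Fin n → (X →L[ℂ] X)) : HilbertTensor X H →L[ℂ] HilbertTensor X H :=
  limUnder atTop fun N : ℕ => ∑ k ∈ Finset.range N, homogPart A T k

/-- Membership in the open unit ball `[B(X)^n]_{<1}`: `‖X₁ X₁* + ⋯ + Xₙ Xₙ*‖ < 1`. -/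
def InOpenRowBall [CompleteSpace X] {n : ℕ} (T : Fin n → (X →L[ℂ] X)) : Prop :=
  ‖∑ i, T i * star (T i)‖ < 1

/-- Membership in the closed ball `[B(K)^n]_r`: `‖T₁ T₁* + ⋯ + Tₙ Tₙ*‖^{1/2} ≤ r`. -/
def InClosedRowBall [CompleteSpace X] {n : ℕ} (r : ℝ) (T : Fin n → (X →L[ℂ] X)) : Prop :=
  √‖∑ i, T i * star (T i)‖ ≤ r

end Operators

/-- The power series with coefficients `A` generates a (universal) holomorphic function on the open
unit balls `[B(X)^n]_{<1}`: its partial sums converge in operator norm at every point of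
`[B(X)^n]_{<1}`, for every complex Hilbert space `X` (in the universe `u`). -/
def IsUniversalHolomorphic {H : Type v} [NormedAddCommGroup H] [InnerProductSpace ℂ H]
    {n : ℕ} (A : FreeMonoid (Fin n) → (H →L[ℂ] H)) : Prop :=
  ∀ (X : Type u) [NormedAddCommGroup X] [InnerProductSpace ℂ X] [CompleteSpace X]
    (T : Fin n → (X →L[ℂ] X)), InOpenRowBall T →
    ∃ L : HilbertTensor X H →L[ℂ] HilbertTensor X H,
      Tendsto (fun N : ℕ => ∑ k ∈ Finset.range N, homogPart A T k) atTop (𝓝 L)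

/-!
A power series `G(z) = ∑ z ^ m • G_m` with absolutely summable operator coefficients and
`Re G ≤ 1` on the unit circle satisfies the Carathéodory-type inequality `‖G_k‖ ≤ 2 ‖1 - G_0‖` for
`k ≥ 1`: put `P = 1 - G` and average `Re ⟪x - z^k y, P(z) (x - z^k y)⟫ ≥ 0` over the circle;
only `⟪x, P_0 x⟫ + ⟪y, P_0 y⟫ - ⟪y, P_k x⟫` survives. Applied to `z ↦ F(z T)`, whose coefficients
are the homogeneous parts of `F` at `T`, and rescaled by homogeneity, this gives
`‖F_k(T)‖ ≤ 2 ‖1 - A_(0)‖ r ^ k` on the closed row ball of radius `r`, and the geometric series at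
`r = 1/3` sums to `‖1 - A_(0)‖`.

The hypotheses concern Hilbert spaces in one universe only. Since `F_k(T)` at a given tensor
involves finitely many vectors `T_α x` with `|α| ≤ k`, the bound on `‖F_k‖` passes to any other
universe by compressing `T` to the finite-dimensional span of these vectors, and compressions stay
in the row ball.
-/

section CircleAverage

open Real (circleAverage)

theorem circleAverage_zpow (j : ℤ) :
    circleAverage (fun z : ℂ => z ^ j) 0 1 = if j = 0 then 1 else 0 := by
  split_ifs with hj
  · simp only [hj, zpow_zero]
    exact Real.circleAverage_const 1 0 1
  · have hint : (∮ z in C((0 : ℂ), 1), z⁻¹ * z ^ j) = ∮ z in C((0 : ℂ), 1), (z - 0) ^ (j - 1) := by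
      refine circleIntegral.integral_congr zero_le_one fun z hz => ?_
      have hz0 : z ≠ 0 := ne_zero_of_mem_unit_sphere ⟨z, hz⟩
      simp [zpow_sub_one₀ hz0, mul_comm]
    rw [Real.circleAverage_eq_circleIntegral one_ne_zero]
    simp only [sub_zero, smul_eq_mul] at hint ⊢
    rw [hint]
    simpa using circleIntegral.integral_sub_zpow_of_ne (n := j - 1) (by lia) 0 0 1

theorem re_circleAverage_nonneg {f : ℂ → ℂ} {c : ℂ} {R : ℝ}
    (hf : ∀ z ∈ Metric.sphere c |R|, 0 ≤ (f z).re) : 0 ≤ (circleAverage f c R).re := by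
  by_cases hint : CircleIntegrable f c R
  · rw [← Complex.reCLM_apply, ← Complex.reCLM.circleAverage_comp_comm hint]
    exact Real.circleAverage_nonneg_of_nonneg hf
  · rw [Real.circleAverage.integral_undef hint, Complex.zero_re]

theorem hasSum_circleAverage {E : Type*} [NormedAddCommGroup E] [NormedSpace ℝ E]
    [CompleteSpace E] {f : ℕ → ℂ → E} {b : ℕ → ℝ} {c : ℂ} {R : ℝ} (hb : Summable b)
    (hf : ∀ m, ContinuousOn (f m) (Metric.sphere c |R|))
    (hfb : ∀ m, ∀ z ∈ Metric.sphere c |R|, ‖f m z‖ ≤ b m) :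
    HasSum (fun m => circleAverage (f m) c R) (circleAverage (fun z => ∑' m, f m z) c R) := by
  refine HasSum.const_smul _ ?_
  have hmem := circleMap_mem_sphere' c R
  refine intervalIntegral.hasSum_integral_of_dominated_convergence (fun m _ => b m)
    (fun m => ?_) (fun m => .of_forall fun θ _ => hfb m _ (hmem θ)) (.of_forall fun _ _ => hb)
    intervalIntegrable_const (.of_forall fun θ _ => ?_)
  · exact ((hf m).comp_continuous (continuous_circleMap c R) hmem).aestronglyMeasurable
  · exact (Summable.of_norm_bounded hb fun m => hfb m _ (hmem θ)).hasSum

end CircleAverage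

section OperatorPowerSeries

-- The lemmas of this section are stated for operators because they fail to apply to operators on
-- `HilbertTensor X H` when stated for a general normed space: instance search does not find
-- `NormSMulClass ℂ` for them.
variable {𝕜 M : Type*} [NontriviallyNormedField 𝕜] [NormedAddCommGroup M] [NormedSpace 𝕜 M]

theorem norm_smul_clm (c : 𝕜) (S : M →L[𝕜] M) : ‖c • S‖ = ‖c‖ * ‖S‖ :=
  norm_smul c S

theorem summable_pow_smul [CompleteSpace M] {G : ℕ → M →L[𝕜] M} (hG : Summable fun m => ‖G m‖)
    {z : 𝕜} (hz : ‖z‖ = 1) : Summable fun m => z ^ m • G m :=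
  .of_norm (by simpa [norm_smul, hz] using hG)

theorem summable_norm_of_tendsto_sum_pow_smul {G : ℕ → M →L[𝕜] M} {c : 𝕜} (hc : 1 < ‖c‖)
    {L : M →L[𝕜] M} (hL : Tendsto (fun N => ∑ m ∈ Finset.range N, c ^ m • G m) atTop (𝓝 L)) :
    Summable fun m => ‖G m‖ := by
  obtain ⟨C, hC⟩ := exists_norm_le_of_cauchySeq hL.cauchySeq
  have hc0 : 0 < ‖c‖ := one_pos.trans hc
  have hgeom : Summable fun m : ℕ => C * ‖c‖⁻¹ ^ m :=
    (summable_geometric_of_lt_one (by positivity) (inv_lt_one_of_one_lt₀ hc)).mul_left C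
  refine hgeom.of_nonneg_of_le (fun m => norm_nonneg (G m)) fun m => ?_
  rw [inv_pow, ← div_eq_mul_inv, le_div_iff₀' (pow_pos hc0 m), ← norm_pow, ← norm_smul]
  exact hC m

end OperatorPowerSeries

section CoefficientEstimates

open Real (circleAverage)

variable {M : Type*} [NormedAddCommGroup M] [InnerProductSpace ℂ M]

theorem inner_sub_pow_smul_apply (S : M →L[ℂ] M) (x y : M) (m k : ℕ) {z : ℂ} (hz : ‖z‖ = 1) :
    inner ℂ (x - z ^ k • y) (z ^ m • S (x - z ^ k • y)) =
      (inner ℂ x (S x) + inner ℂ y (S y)) * z ^ (m : ℤ) -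
        inner ℂ x (S y) * z ^ (m + k : ℤ) - inner ℂ y (S x) * z ^ (m - k : ℤ) := by
  have hz0 : z ≠ 0 := norm_ne_zero_iff.1 (hz ▸ one_ne_zero)
  have hconj : (starRingEnd ℂ) z = z⁻¹ := (Complex.inv_eq_conj hz).symm
  simp only [map_sub, map_smul, inner_sub_left, inner_sub_right, inner_smul_left,
    inner_smul_right, map_pow, hconj, inv_pow, zpow_add₀ hz0, zpow_sub₀ hz0, zpow_natCast]
  field_simp
  ring

theorem circleAverage_inner_sub_pow_smul_apply (S : M →L[ℂ] M) (x y : M) (m : ℕ) {k : ℕ}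
    (hk : k ≠ 0) :
    circleAverage (fun z => inner ℂ (x - z ^ k • y) (z ^ m • S (x - z ^ k • y))) 0 1 =
      (if m = 0 then inner ℂ x (S x) + inner ℂ y (S y) else 0) -
        if m = k then inner ℂ y (S x) else 0 := by
  have hint (a : ℂ) (j : ℤ) : CircleIntegrable (fun z : ℂ => a * z ^ j) 0 1 := by
    refine ContinuousOn.circleIntegrable zero_le_one <| continuousOn_const.mul fun z hz => ?_
    exact (continuousAt_zpow₀ z j (.inl (ne_zero_of_mem_unit_sphere ⟨z, hz⟩))).continuousWithinAt
  have havg (a : ℂ) (j : ℤ) :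
      circleAverage (fun z : ℂ => a * z ^ j) 0 1 = if j = 0 then a else 0 := by
    simp only [← smul_eq_mul, Real.circleAverage_fun_smul, circleAverage_zpow]
    simp
  rw [Real.circleAverage_congr_sphere fun z hz =>
      inner_sub_pow_smul_apply S x y m k (by simpa using hz),
    Real.circleAverage_fun_sub (f₁ := fun z => _ - _) ((hint _ _).sub (hint _ _)) (hint _ _),
    Real.circleAverage_fun_sub (hint _ _) (hint _ _), havg, havg, havg]
  have hmk : (m + k : ℤ) ≠ 0 := by lia
  simp only [hmk, Nat.cast_eq_zero, sub_eq_zero, Nat.cast_inj, if_false, sub_zero]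

variable [CompleteSpace M]

theorem re_inner_realPart (S : M →L[ℂ] M) (v : M) :
    (inner ℂ v ((ℜ S : M →L[ℂ] M) v)).re = (inner ℂ v (S v)).re := by
  have hstar : (inner ℂ v (star S v)).re = (inner ℂ v (S v)).re := by
    rw [ContinuousLinearMap.star_eq_adjoint, ContinuousLinearMap.adjoint_inner_right,
      ← inner_conj_symm, Complex.conj_re]
  rw [realPart_apply_coe, smul_apply, add_apply, inner_smul_right_eq_smul, inner_add_right,
    Complex.smul_re, Complex.add_re, hstar, smul_eq_mul]
  ring

variable {G : ℕ → M →L[ℂ] M} (hG : Summable fun m => ‖G m‖)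

include hG

theorem hasSum_inner_pow_smul_apply {z : ℂ} (hz : ‖z‖ = 1) (v : M) :
    HasSum (fun m => inner ℂ v (z ^ m • G m v)) (inner ℂ v ((∑' m, z ^ m • G m) v)) :=
  ((summable_pow_smul hG hz).hasSum.mapL (ContinuousLinearMap.apply ℂ M v)).mapL (innerSL ℂ v)

theorem hasSum_circleAverage_inner_sub_pow_smul (x y : M) (k : ℕ) :
    HasSum
      (fun m => circleAverage
        (fun z => inner ℂ (x - z ^ k • y) (z ^ m • G m (x - z ^ k • y))) 0 1)
      (circleAverage
        (fun z => inner ℂ (x - z ^ k • y) ((∑' m, z ^ m • G m) (x - z ^ k • y))) 0 1) := by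
  have hbound (m : ℕ) (z : ℂ) (hz : z ∈ Metric.sphere (0 : ℂ) |1|) :
      ‖inner ℂ (x - z ^ k • y) (z ^ m • G m (x - z ^ k • y))‖ ≤ (‖x‖ + ‖y‖) ^ 2 * ‖G m‖ := by
    have hz : ‖z‖ = 1 := by simpa using hz
    have hv : ‖x - z ^ k • y‖ ≤ ‖x‖ + ‖y‖ := by
      simpa [norm_smul, hz] using norm_sub_le x (z ^ k • y)
    generalize x - z ^ k • y = v at hv ⊢
    calc ‖inner ℂ v (z ^ m • G m v)‖ ≤ ‖v‖ * ‖z ^ m • G m v‖ := norm_inner_le_norm _ _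
      _ = ‖v‖ * ‖G m v‖ := by simp [norm_smul, hz]
      _ ≤ ‖v‖ * (‖G m‖ * ‖v‖) := by gcongr; exact (G m).le_opNorm _
      _ = ‖v‖ ^ 2 * ‖G m‖ := by ring
      _ ≤ (‖x‖ + ‖y‖) ^ 2 * ‖G m‖ := by gcongr
  have hcont (m : ℕ) :
      Continuous fun z : ℂ => inner ℂ (x - z ^ k • y) (z ^ m • G m (x - z ^ k • y)) := by
    fun_prop
  rw [Real.circleAverage_congr_sphere fun z hz =>
    (hasSum_inner_pow_smul_apply hG (by simpa using hz) (x - z ^ k • y)).tsum_eq.symm]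
  exact hasSum_circleAverage (hG.mul_left _) (fun m => (hcont m).continuousOn) hbound

theorem re_inner_coeff_le (hre : ∀ z : ℂ, ‖z‖ = 1 → 0 ≤ (ℜ (∑' m, z ^ m • G m) : M →L[ℂ] M))
    {k : ℕ} (hk : k ≠ 0) (x y : M) :
    (inner ℂ y (G k x)).re ≤ (inner ℂ x (G 0 x)).re + (inner ℂ y (G 0 y)).re := by
  have havg := hasSum_circleAverage_inner_sub_pow_smul hG x y k
  simp only [circleAverage_inner_sub_pow_smul_apply _ x y _ hk] at havg
  have hcoeff : HasSum
      (fun m => (if m = 0 then inner ℂ x (G m x) + inner ℂ y (G m y) else 0) -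
        if m = k then inner ℂ y (G m x) else 0)
      (inner ℂ x (G 0 x) + inner ℂ y (G 0 y) - inner ℂ y (G k x)) := by
    refine .sub ?_ ?_
    · simpa using hasSum_single (f := fun m => if m = 0 then _ else _) 0 fun m hm => if_neg hm
    · simpa using hasSum_single (f := fun m => if m = k then _ else _) k fun m hm => if_neg hm
  have hpos : 0 ≤ (circleAverage
      (fun z => inner ℂ (x - z ^ k • y) ((∑' m, z ^ m • G m) (x - z ^ k • y))) 0 1).re := by
    refine re_circleAverage_nonneg fun z hz => ?_
    rw [← re_inner_realPart]
    exact ((ContinuousLinearMap.nonneg_iff_isPositive _).1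
      (hre z (by simpa using hz))).re_inner_nonneg_right _
  rw [havg.unique hcoeff, Complex.sub_re, Complex.add_re] at hpos
  linarith

theorem norm_coeff_le_two_mul_norm_coeff_zero
    (hre : ∀ z : ℂ, ‖z‖ = 1 → 0 ≤ (ℜ (∑' m, z ^ m • G m) : M →L[ℂ] M)) {k : ℕ} (hk : k ≠ 0) :
    ‖G k‖ ≤ 2 * ‖G 0‖ := by
  have hzero (u : M) (hu : ‖u‖ = 1) : (inner ℂ u (G 0 u)).re ≤ ‖G 0‖ :=
    calc (inner ℂ u (G 0 u)).re ≤ ‖u‖ * ‖G 0 u‖ := re_inner_le_norm (𝕜 := ℂ) u (G 0 u)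
      _ ≤ ‖G 0‖ := by simpa [hu] using (G 0).le_opNorm u
  refine ContinuousLinearMap.opNorm_le_of_re_inner_le (by positivity) fun x y hx hy => ?_
  calc (inner ℂ (G k x) y).re = (inner ℂ y (G k x)).re := inner_re_symm (𝕜 := ℂ) _ _
    _ ≤ (inner ℂ x (G 0 x)).re + (inner ℂ y (G 0 y)).re := re_inner_coeff_le hG hre hk x y
    _ ≤ 2 * ‖G 0‖ := by linarith [hzero x hx, hzero y hy]

theorem norm_coeff_le_two_mul_norm_one_sub_coeff_zero
    (hre : ∀ z : ℂ, ‖z‖ = 1 → (ℜ (∑' m, z ^ m • G m) : M →L[ℂ] M) ≤ 1) {k : ℕ} (hk : k ≠ 0) :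
    ‖G k‖ ≤ 2 * ‖1 - G 0‖ := by
  set G' : ℕ → M →L[ℂ] M := Pi.single 0 1 - G
  have hG' : Summable fun m => ‖G' m‖ := by
    rw [← summable_nat_add_iff 1]
    simpa [G'] using (summable_nat_add_iff 1).2 hG
  have hsum (z : ℂ) (hz : ‖z‖ = 1) : ∑' m, z ^ m • G' m = 1 - ∑' m, z ^ m • G m := by
    have hone : HasSum (fun m => z ^ m • (Pi.single 0 1 : ℕ → M →L[ℂ] M) m) 1 := by
      simpa using hasSum_single (f := fun m => z ^ m • (Pi.single 0 1 : ℕ → M →L[ℂ] M) m) 0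
        fun m hm => by simp [hm]
    have hsub := hone.sub (summable_pow_smul hG hz).hasSum
    simpa only [G', Pi.sub_apply, smul_sub] using hsub.tsum_eq
  have hre' (z : ℂ) (hz : ‖z‖ = 1) : 0 ≤ (ℜ (∑' m, z ^ m • G' m) : M →L[ℂ] M) := by
    rw [hsum z hz, map_sub, realPart_one]
    simpa using hre z hz
  simpa [G', hk] using norm_coeff_le_two_mul_norm_coeff_zero hG' hre' hk

end CoefficientEstimates

section HomogeneousParts

variable {X H : Type*} [NormedAddCommGroup X] [InnerProductSpace ℂ X]
  [NormedAddCommGroup H] [InnerProductSpace ℂ H]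

theorem HilbertTensor.clm_ext {S T : HilbertTensor X H →L[ℂ] HilbertTensor X H}
    (h : ∀ t : X ⊗[ℂ] H, S (t : HilbertTensor X H) = T (t : HilbertTensor X H)) : S = T :=
  DFunLike.coe_injective <| UniformSpace.Completion.ext S.continuous T.continuous h

theorem HilbertTensor.opNorm_le {S : HilbertTensor X H →L[ℂ] HilbertTensor X H} {C : ℝ}
    (hC : 0 ≤ C) (h : ∀ t : X ⊗[ℂ] H, ‖S (t : HilbertTensor X H)‖ ≤ C * ‖t‖) : ‖S‖ ≤ C := by
  refine S.opNorm_le_bound hC fun x => ?_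
  induction x using UniformSpace.Completion.induction_on with
  | hp => exact isClosed_le (by fun_prop) (by fun_prop)
  | ih t => simpa using h t

theorem opTensor_coe (T : X →L[ℂ] X) (A : H →L[ℂ] H) (t : X ⊗[ℂ] H) :
    opTensor T A (t : HilbertTensor X H) =
      ((TensorProduct.mapL T A t : X ⊗[ℂ] H) : HilbertTensor X H) := by
  simp [opTensor]

theorem norm_opTensor_le (T : X →L[ℂ] X) (A : H →L[ℂ] H) : ‖opTensor T A‖ ≤ ‖T‖ * ‖A‖ := by
  refine HilbertTensor.opNorm_le (by positivity) fun t => ?_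
  rw [opTensor_coe, UniformSpace.Completion.norm_coe]
  exact ContinuousLinearMap.le_of_opNorm_le _ (TensorProduct.norm_mapL_le T A) t

theorem norm_opTensor_one_le (A : H →L[ℂ] H) : ‖opTensor (1 : X →L[ℂ] X) A‖ ≤ ‖A‖ :=
  (norm_opTensor_le _ _).trans <|
    mul_le_of_le_one_left (norm_nonneg _) ContinuousLinearMap.norm_id_le

theorem opTensor_smul_left (c : ℂ) (T : X →L[ℂ] X) (A : H →L[ℂ] H) :
    opTensor (c • T) A = c • opTensor T A := by
  refine HilbertTensor.clm_ext fun t => ?_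
  simp only [smul_apply, opTensor_coe, TensorProduct.mapL_apply,
    ContinuousLinearMap.toLinearMap_smul, TensorProduct.map_smul_left, LinearMap.smul_apply,
    UniformSpace.Completion.coe_smul]

theorem one_sub_opTensor_one (A : H →L[ℂ] H) :
    1 - opTensor (1 : X →L[ℂ] X) A = opTensor 1 (1 - A) := by
  refine HilbertTensor.clm_ext fun t => ?_
  induction t with
  | zero => simp [UniformSpace.Completion.coe_zero]
  | tmul x h => simp [opTensor_tmul, TensorProduct.tmul_sub, UniformSpace.Completion.coe_sub]
  | add s t hs ht => simp only [UniformSpace.Completion.coe_add, map_add, hs, ht]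

variable {n : ℕ}

theorem wordOp_ofList (T : Fin n → (X →L[ℂ] X)) (l : List (Fin n)) :
    wordOp T (FreeMonoid.ofList l) = (l.map T).prod :=
  FreeMonoid.lift_ofList _ _

theorem wordOp_smul (c : ℂ) (T : Fin n → (X →L[ℂ] X)) (l : List (Fin n)) :
    wordOp (c • T) (FreeMonoid.ofList l) = c ^ l.length • wordOp T (FreeMonoid.ofList l) := by
  simp only [wordOp_ofList]
  induction l with
  | nil => simp
  | cons i l ih => simp [ih, pow_succ', smul_smul, mul_comm]

variable (A : FreeMonoid (Fin n) → (H →L[ℂ] H)) (T : Fin n → (X →L[ℂ] X))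

theorem homogPart_zero : homogPart A T 0 = opTensor 1 (A 1) := by
  simp [homogPart, wordOp]

theorem homogPart_smul (c : ℂ) (k : ℕ) : homogPart A (c • T) k = c ^ k • homogPart A T k := by
  simp only [homogPart, Finset.smul_sum, wordOp_smul, List.length_ofFn, opTensor_smul_left]

theorem homogPart_coe (k : ℕ) (t : X ⊗[ℂ] H) :
    homogPart A T k (t : HilbertTensor X H) =
      ((∑ w : Fin k → Fin n, TensorProduct.mapL (wordOp T (FreeMonoid.ofList (List.ofFn w)))
        (A (FreeMonoid.ofList (List.ofFn w))) t : X ⊗[ℂ] H) : HilbertTensor X H) := by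
  simp only [homogPart, sum_apply, opTensor_coe]
  exact (map_sum (UniformSpace.Completion.toComplL (𝕜 := ℂ) (E := X ⊗[ℂ] H)) _ _).symm

theorem norm_homogPart_smul (c : ℂ) (k : ℕ) :
    ‖homogPart A (c • T) k‖ = ‖c‖ ^ k * ‖homogPart A T k‖ := by
  rw [homogPart_smul, norm_smul_clm, norm_pow]

variable {A T}

theorem norm_homogPart_zero_le : ‖homogPart A T 0‖ ≤ ‖A 1‖ := by
  rw [homogPart_zero]
  exact norm_opTensor_one_le _

theorem norm_one_sub_homogPart_zero_le : ‖1 - homogPart A T 0‖ ≤ ‖1 - A 1‖ := by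
  rw [homogPart_zero, one_sub_opTensor_one]
  exact norm_opTensor_one_le _

theorem seriesValue_smul (h : Summable fun m => ‖homogPart A T m‖) {z : ℂ} (hz : ‖z‖ = 1) :
    seriesValue A (z • T) = ∑' m, z ^ m • homogPart A T m := by
  simp only [seriesValue, homogPart_smul]
  exact (summable_pow_smul h hz).hasSum.tendsto_sum_nat.limUnder_eq

end HomogeneousParts

section RowBalls

variable {X : Type*} [NormedAddCommGroup X] [InnerProductSpace ℂ X] [CompleteSpace X]
  {n : ℕ} {T : Fin n → (X →L[ℂ] X)}

theorem norm_sum_smul_mul_star_smul (c : ℂ) (T : Fin n → (X →L[ℂ] X)) :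
    ‖∑ i, (c • T) i * star ((c • T) i)‖ = ‖c‖ ^ 2 * ‖∑ i, T i * star (T i)‖ := by
  have hsum : ∑ i, (c • T) i * star ((c • T) i) = (c * star c) • ∑ i, T i * star (T i) := by
    simp only [Finset.smul_sum, Pi.smul_apply, star_smul, smul_mul_smul_comm]
  rw [hsum, norm_smul, norm_mul, norm_star, sq]

theorem InOpenRowBall.smul (hT : InOpenRowBall T) {z : ℂ} (hz : ‖z‖ ≤ 1) :
    InOpenRowBall (z • T) := by
  rw [InOpenRowBall, norm_sum_smul_mul_star_smul]
  exact (mul_le_of_le_one_left (norm_nonneg _) (pow_le_one₀ (norm_nonneg _) hz)).trans_lt hT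

theorem InOpenRowBall.exists_one_lt_norm_smul (hT : InOpenRowBall T) :
    ∃ c : ℂ, 1 < ‖c‖ ∧ InOpenRowBall (c • T) := by
  have hlim : Tendsto (fun t : ℝ => t ^ 2 * ‖∑ i, T i * star (T i)‖) (𝓝[>] 1)
      (𝓝 ‖∑ i, T i * star (T i)‖) :=
    (Continuous.tendsto' (by fun_prop) _ _ (by simp)).mono_left nhdsWithin_le_nhds
  obtain ⟨t, hlt, ht⟩ := ((hlim.eventually_lt_const hT).and self_mem_nhdsWithin).exists
  have hnorm : ‖(t : ℂ)‖ = t := Complex.norm_of_nonneg (zero_le_one.trans ht.le)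
  exact ⟨t, hnorm.symm ▸ ht, by rwa [InOpenRowBall, norm_sum_smul_mul_star_smul, hnorm]⟩

theorem InClosedRowBall.inv_smul {r s : ℝ} (hT : InClosedRowBall r T) (hrs : r < s) :
    InOpenRowBall ((s : ℂ)⁻¹ • T) := by
  have hs : 0 < s := ((Real.sqrt_nonneg _).trans hT).trans_lt hrs
  have hlt : ‖∑ i, T i * star (T i)‖ < s ^ 2 := (Real.sqrt_lt' hs).1 (hT.trans_lt hrs)
  rw [InOpenRowBall, norm_sum_smul_mul_star_smul, norm_inv, Complex.norm_of_nonneg hs.le, inv_pow,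
    inv_mul_lt_one₀ (by positivity)]
  exact hlt

end RowBalls

section OpenRowBall

variable {H : Type v} [NormedAddCommGroup H] [InnerProductSpace ℂ H] {n : ℕ}
  {A : FreeMonoid (Fin n) → (H →L[ℂ] H)} (hF : IsUniversalHolomorphic.{u, v} A)
  {X : Type u} [NormedAddCommGroup X] [InnerProductSpace ℂ X] [CompleteSpace X]
  {T : Fin n → (X →L[ℂ] X)}

include hF

theorem IsUniversalHolomorphic.summable_norm_homogPart (hT : InOpenRowBall T) :
    Summable fun m => ‖homogPart A T m‖ := by
  obtain ⟨c, hc, hcT⟩ := hT.exists_one_lt_norm_smul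
  obtain ⟨L, hL⟩ := hF X (c • T) hcT
  simp only [homogPart_smul] at hL
  exact summable_norm_of_tendsto_sum_pow_smul hc hL

theorem norm_homogPart_le_of_inOpenRowBall
    (hF_re : ∀ T : Fin n → (X →L[ℂ] X), InOpenRowBall T →
      (ℜ (seriesValue A T) : HilbertTensor X H →L[ℂ] HilbertTensor X H) ≤ 1)
    (hT : InOpenRowBall T) {k : ℕ} (hk : k ≠ 0) : ‖homogPart A T k‖ ≤ 2 * ‖1 - A 1‖ := by
  have hsum := hF.summable_norm_homogPart hT
  have hre (z : ℂ) (hz : ‖z‖ = 1) :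
      (ℜ (∑' m, z ^ m • homogPart A T m) : HilbertTensor X H →L[ℂ] HilbertTensor X H) ≤ 1 := by
    rw [← seriesValue_smul hsum hz]
    exact hF_re (z • T) (hT.smul hz.le)
  calc ‖homogPart A T k‖ ≤ 2 * ‖1 - homogPart A T 0‖ :=
        norm_coeff_le_two_mul_norm_one_sub_coeff_zero hsum hre hk
    _ ≤ 2 * ‖1 - A 1‖ := by gcongr; exact norm_one_sub_homogPart_zero_le

end OpenRowBall

section Compression

variable {K E : Type*} [NormedAddCommGroup K] [InnerProductSpace ℂ K] [CompleteSpace K]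
  [NormedAddCommGroup E] [InnerProductSpace ℂ E] [CompleteSpace E]

/-- The compression `V* T V` of an operator along an isometry `V`. -/
noncomputable def compression (V : E →ₗᵢ[ℂ] K) (T : K →L[ℂ] K) : E →L[ℂ] E :=
  V.toContinuousLinearMap.adjoint ∘L T ∘L V.toContinuousLinearMap

theorem isometry_apply_adjoint_of_mem_range (V : E →ₗᵢ[ℂ] K) {x : K} (hx : x ∈ Set.range V) :
    V (V.toContinuousLinearMap.adjoint x) = x := by
  obtain ⟨y, rfl⟩ := hx
  exact congrArg V (DFunLike.congr_fun V.adjoint_comp_self y)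

theorem norm_isometry_adjoint_le (V : E →ₗᵢ[ℂ] K) : ‖V.toContinuousLinearMap.adjoint‖ ≤ 1 := by
  rw [LinearIsometryEquiv.norm_map]
  exact V.norm_toContinuousLinearMap_le

theorem norm_compression_le (V : E →ₗᵢ[ℂ] K) (T : K →L[ℂ] K) : ‖compression V T‖ ≤ ‖T‖ :=
  calc ‖compression V T‖
      ≤ ‖V.toContinuousLinearMap.adjoint‖ * (‖T‖ * ‖V.toContinuousLinearMap‖) :=
        (ContinuousLinearMap.opNorm_comp_le _ _).trans <| by
          gcongr; exact ContinuousLinearMap.opNorm_comp_le _ _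
    _ ≤ 1 * (‖T‖ * 1) := by
        gcongr
        exacts [norm_isometry_adjoint_le V, V.norm_toContinuousLinearMap_le]
    _ = ‖T‖ := by ring

theorem isStarProjection_isometry_comp_adjoint (V : E →ₗᵢ[ℂ] K) :
    IsStarProjection (V.toContinuousLinearMap ∘L V.toContinuousLinearMap.adjoint) where
  isIdempotentElem := by
    ext x
    exact isometry_apply_adjoint_of_mem_range V ⟨_, rfl⟩
  isSelfAdjoint := (ContinuousLinearMap.isPositive_self_comp_adjoint _).isSelfAdjoint

theorem compression_mul_star_le (V : E →ₗᵢ[ℂ] K) (T : K →L[ℂ] K) :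
    compression V T * star (compression V T) ≤ compression V (T * star T) := by
  have hpos : (1 - V.toContinuousLinearMap ∘L V.toContinuousLinearMap.adjoint).IsPositive :=
    (ContinuousLinearMap.nonneg_iff_isPositive _).1
      (isStarProjection_isometry_comp_adjoint V).one_sub.nonneg
  rw [ContinuousLinearMap.le_def]
  convert hpos.adjoint_conj (T.adjoint ∘L V.toContinuousLinearMap) using 1
  ext x
  simp [compression, ContinuousLinearMap.star_eq_adjoint, ContinuousLinearMap.adjoint_comp]

variable {n : ℕ} {T : Fin n → (K →L[ℂ] K)}

theorem inOpenRowBall_compression (hT : InOpenRowBall T) (V : E →ₗᵢ[ℂ] K) :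
    InOpenRowBall fun i => compression V (T i) := by
  have hsum : ∑ i, compression V (T i * star (T i)) =
      compression V (∑ i, T i * star (T i)) := by
    ext x
    simp [compression]
  calc ‖∑ i, compression V (T i) * star (compression V (T i))‖
      ≤ ‖∑ i, compression V (T i * star (T i))‖ :=
        CStarAlgebra.norm_le_norm_of_nonneg_of_le
          (Finset.sum_nonneg fun i _ => mul_star_self_nonneg _)
          (Finset.sum_le_sum fun i _ => compression_mul_star_le V (T i))
    _ ≤ ‖∑ i, T i * star (T i)‖ := hsum ▸ norm_compression_le V _
    _ < 1 := hT

theorem apply_wordOp_compression (V : E →ₗᵢ[ℂ] K) {x : K} {k : ℕ}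
    (hx : ∀ l : List (Fin n), l.length ≤ k → wordOp T (FreeMonoid.ofList l) x ∈ Set.range V)
    (l : List (Fin n)) (hl : l.length ≤ k) :
    V (wordOp (fun i => compression V (T i)) (FreeMonoid.ofList l)
      (V.toContinuousLinearMap.adjoint x)) = wordOp T (FreeMonoid.ofList l) x := by
  induction l with
  | nil => simpa [wordOp] using isometry_apply_adjoint_of_mem_range V (hx [] (Nat.zero_le _))
  | cons i l ih =>
    have hl_tail := ih ((Nat.le_succ _).trans hl)
    have hmem := hx (i :: l) hl
    simp only [wordOp_ofList, List.map_cons, List.prod_cons, mul_apply_eq_comp] at hl_tail hmem ⊢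
    rw [compression, ContinuousLinearMap.comp_apply, ContinuousLinearMap.comp_apply,
      LinearIsometry.coe_toContinuousLinearMap, hl_tail]
    exact isometry_apply_adjoint_of_mem_range V hmem

variable {H : Type*} [NormedAddCommGroup H] [InnerProductSpace ℂ H]

theorem norm_homogPart_sum_tmul_le (V : E →ₗᵢ[ℂ] K) (A : FreeMonoid (Fin n) → (H →L[ℂ] H))
    {k : ℕ} {S : Finset (K × H)} (hS : ∀ p ∈ S, ∀ l : List (Fin n), l.length ≤ k →
      wordOp T (FreeMonoid.ofList l) p.1 ∈ Set.range V) :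
    ‖homogPart A T k ((∑ p ∈ S, p.1 ⊗ₜ[ℂ] p.2 : K ⊗[ℂ] H) : HilbertTensor K H)‖ ≤
      ‖homogPart A (fun i => compression V (T i)) k‖ * ‖∑ p ∈ S, p.1 ⊗ₜ[ℂ] p.2‖ := by
  set t := ∑ p ∈ S, p.1 ⊗ₜ[ℂ] p.2 with ht
  set t' := TensorProduct.mapL V.toContinuousLinearMap.adjoint (.id ℂ H) t with ht'
  have hnorm : ‖t'‖ ≤ ‖t‖ := by
    refine (ContinuousLinearMap.le_of_opNorm_le _ (c := 1) ?_ t).trans_eq (one_mul _)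
    exact (TensorProduct.norm_mapL_le _ _).trans <|
      mul_le_one₀ (norm_isometry_adjoint_le V) (norm_nonneg _) ContinuousLinearMap.norm_id_le
  have hword (w : Fin k → Fin n) (B : H →L[ℂ] H) :
      TensorProduct.map V.toLinearMap LinearIsometry.id.toLinearMap
        (TensorProduct.mapL (wordOp (fun i => compression V (T i))
          (FreeMonoid.ofList (List.ofFn w))) B t') =
      TensorProduct.mapL (wordOp T (FreeMonoid.ofList (List.ofFn w))) B t := by
    simp only [ht, ht', map_sum, TensorProduct.mapL_apply, TensorProduct.map_tmul]
    exact Finset.sum_congr rfl fun p hp => congrArg (· ⊗ₜ[ℂ] B p.2) <|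
      apply_wordOp_compression V (hS p hp) _ List.length_ofFn.le
  calc ‖homogPart A T k (t : HilbertTensor K H)‖
      = ‖homogPart A (fun i => compression V (T i)) k (t' : HilbertTensor E H)‖ := by
        simp only [homogPart_coe, UniformSpace.Completion.norm_coe, ← hword, ← map_sum,
          TensorProduct.norm_map]
    _ ≤ ‖homogPart A (fun i => compression V (T i)) k‖ * ‖t'‖ := by
        rw [← UniformSpace.Completion.norm_coe t']
        exact ContinuousLinearMap.le_opNorm _ _
    _ ≤ _ := by gcongr

end Compression

theorem exists_isometry_orbit_subset_range {K : Type w} [NormedAddCommGroup K]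
    [InnerProductSpace ℂ K] {n : ℕ} (T : Fin n → (K →L[ℂ] K)) {s : Set K} (hs : s.Finite) (k : ℕ) :
    ∃ (d : ℕ) (V : EuclideanSpace ℂ (ULift.{u} (Fin d)) →ₗᵢ[ℂ] K), ∀ x ∈ s,
      ∀ l : List (Fin n), l.length ≤ k → wordOp T (FreeMonoid.ofList l) x ∈ Set.range V := by
  set orbit : Set K :=
    Set.image2 (fun (l : List (Fin n)) x => wordOp T (FreeMonoid.ofList l) x) {l | l.length ≤ k} s
  set W := Submodule.span ℂ orbit
  have : FiniteDimensional ℂ W :=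
    FiniteDimensional.span_of_finite ℂ ((List.finite_length_le (Fin n) k).image2 _ hs)
  let b := (stdOrthonormalBasis ℂ W).reindex Equiv.ulift.{u}.symm
  refine ⟨_, W.subtypeₗᵢ.comp b.repr.symm.toLinearIsometry, fun x hx l hl => ?_⟩
  have hmem : wordOp T (FreeMonoid.ofList l) x ∈ W := Submodule.subset_span ⟨l, hl, x, hx, rfl⟩
  exact ⟨b.repr ⟨_, hmem⟩, by simp⟩

section UniverseTransfer

variable {H : Type v} [NormedAddCommGroup H] [InnerProductSpace ℂ H] {n : ℕ}
  {A : FreeMonoid (Fin n) → (H →L[ℂ] H)}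
  {K : Type w} [NormedAddCommGroup K] [InnerProductSpace ℂ K] [CompleteSpace K]
  {T : Fin n → (K →L[ℂ] K)}

theorem norm_homogPart_le_of_forall_inOpenRowBall {C : ℝ} {k : ℕ}
    (h : ∀ (X : Type u) [NormedAddCommGroup X] [InnerProductSpace ℂ X] [CompleteSpace X]
      (T : Fin n → (X →L[ℂ] X)), InOpenRowBall T → ‖homogPart A T k‖ ≤ C)
    (hT : InOpenRowBall T) : ‖homogPart A T k‖ ≤ C := by
  have hC : 0 ≤ C := (norm_nonneg (homogPart A 0 k)).trans <|
    h (EuclideanSpace ℂ PUnit.{u + 1}) 0 (by simp [InOpenRowBall])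
  refine HilbertTensor.opNorm_le hC fun t => ?_
  obtain ⟨S, rfl⟩ := TensorProduct.exists_finset t
  obtain ⟨d, V, hV⟩ := exists_isometry_orbit_subset_range.{u} T (S.finite_toSet.image Prod.fst) k
  refine (norm_homogPart_sum_tmul_le V A fun p hp => hV p.1 ⟨p, hp, rfl⟩).trans ?_
  gcongr
  exact h _ _ (inOpenRowBall_compression hT V)

theorem norm_homogPart_le_mul_pow_of_forall_inOpenRowBall {C r : ℝ} {k : ℕ}
    (h : ∀ T : Fin n → (K →L[ℂ] K), InOpenRowBall T → ‖homogPart A T k‖ ≤ C)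
    (hT : InClosedRowBall r T) : ‖homogPart A T k‖ ≤ C * r ^ k := by
  have hscaled (s : ℝ) (hs : r < s) : ‖homogPart A T k‖ ≤ C * s ^ k := by
    have hs0 : 0 < s := ((Real.sqrt_nonneg _).trans hT).trans_lt hs
    have hle := h _ (hT.inv_smul hs)
    rw [norm_homogPart_smul, norm_inv, Complex.norm_of_nonneg hs0.le, inv_pow,
      inv_mul_le_iff₀ (by positivity)] at hle
    rwa [mul_comm]
  have hlim : Tendsto (fun s : ℝ => C * s ^ k) (𝓝[>] r) (𝓝 (C * r ^ k)) :=
    (Continuous.tendsto (by fun_prop) r).mono_left nhdsWithin_le_nhds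
  exact ge_of_tendsto hlim (eventually_mem_nhdsWithin.mono hscaled)

end UniverseTransfer

theorem summable_and_tsum_le_of_le_geometric {a : ℕ → ℝ} {C r : ℝ} (ha : ∀ k, 0 ≤ a k)
    (hr0 : 0 ≤ r) (hr1 : r < 1) (hle : ∀ k, k ≠ 0 → a k ≤ C * r ^ k) :
    Summable a ∧ ∑' k, a k ≤ a 0 + C * (r / (1 - r)) := by
  have hgeom : HasSum (fun k => C * r ^ (k + 1)) (C * (r / (1 - r))) := by
    simpa only [pow_succ', div_eq_mul_inv] using
      ((hasSum_geometric_of_lt_one hr0 hr1).mul_left r).mul_left C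
  have hsucc : Summable fun k => a (k + 1) :=
    hgeom.summable.of_nonneg_of_le (fun k => ha _) fun k => hle _ k.succ_ne_zero
  have hsum : Summable a := (summable_nat_add_iff 1).1 hsucc
  refine ⟨hsum, ?_⟩
  rw [hsum.tsum_eq_zero_add, ← hgeom.tsum_eq]
  gcongr
  · exact hgeom.summable
  · exact hle _ (Nat.succ_ne_zero _)

theorem theorem2p6_general {H : Type v} [NormedAddCommGroup H] [InnerProductSpace ℂ H]
    {n : ℕ} (A : FreeMonoid (Fin n) → (H →L[ℂ] H)) (hF : IsUniversalHolomorphic.{u, v} A)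
    (hF_re : ∀ (X : Type u) [NormedAddCommGroup X] [InnerProductSpace ℂ X] [CompleteSpace X]
      (T : Fin n → (X →L[ℂ] X)), InOpenRowBall T →
        (ℜ (seriesValue A T) : HilbertTensor X H →L[ℂ] HilbertTensor X H) ≤ 1)
    {K : Type w} [NormedAddCommGroup K] [InnerProductSpace ℂ K] [CompleteSpace K]
    (T : Fin n → (K →L[ℂ] K)) {r : ℝ} (hr : r < 1) (hT : InClosedRowBall r T) :
    Summable (fun k : ℕ => ‖homogPart A T k‖) ∧
      ∑' k : ℕ, ‖homogPart A T k‖ ≤ ‖A 1‖ + 2 * ‖1 - A 1‖ * (r / (1 - r)) := by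
  have hcoeff (k : ℕ) (hk : k ≠ 0) : ‖homogPart A T k‖ ≤ 2 * ‖1 - A 1‖ * r ^ k :=
    norm_homogPart_le_mul_pow_of_forall_inOpenRowBall
      (fun _ => norm_homogPart_le_of_forall_inOpenRowBall fun X _ _ _ _ hS =>
        norm_homogPart_le_of_inOpenRowBall hF (hF_re X) hS hk) hT
  have hr0 : 0 ≤ r := (Real.sqrt_nonneg _).trans hT
  obtain ⟨hsum, hle⟩ :=
    summable_and_tsum_le_of_le_geometric (fun k => norm_nonneg (homogPart A T k)) hr0 hr hcoeff
  exact ⟨hsum, hle.trans (by gcongr; exact norm_homogPart_zero_le)⟩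

theorem theorem2p6 {H : Type v} [NormedAddCommGroup H] [InnerProductSpace ℂ H]
    [CompleteSpace H] {n : ℕ} (A : FreeMonoid (Fin n) → (H →L[ℂ] H))
    (hF : IsUniversalHolomorphic.{u, v} A)
    (hF_zero : ∀ (X : Type u) [NormedAddCommGroup X] [InnerProductSpace ℂ X] [CompleteSpace X],
      0 ≤ seriesValue A (0 : Fin n → (X →L[ℂ] X)))
    (hF_re : ∀ (X : Type u) [NormedAddCommGroup X] [InnerProductSpace ℂ X] [CompleteSpace X]
      (T : Fin n → (X →L[ℂ] X)), InOpenRowBall T →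
        (ℜ (seriesValue A T) : HilbertTensor X H →L[ℂ] HilbertTensor X H) ≤ 1)
    {K : Type w} [NormedAddCommGroup K] [InnerProductSpace ℂ K] [CompleteSpace K]
    (T : Fin n → (K →L[ℂ] K)) (hT : InClosedRowBall (1 / 3) T) :
    Summable (fun k : ℕ => ‖homogPart A T k‖) ∧
      ∑' k : ℕ, ‖homogPart A T k‖ ≤ ‖A 1‖ + ‖1 - A 1‖ := by
  have hbound := theorem2p6_general A hF hF_re T (by norm_num) hT
  rwa [show 2 * ‖1 - A 1‖ * (1 / 3 / (1 - 1 / 3)) = ‖1 - A 1‖ by ring] at hbound
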